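/- For an integer $n\ge 1$, a Littlewood polynomial of degree $n$ is a polynomial $f(z)=a_0+a_1z+\dots+a_nz^n$ with $a_j\in\{-1,1\}$ for all $0\le j\le n$. Let $N(f)$ and $U(f)$ denote the numbers of complex zeros of $f$, counted with multiplicity, in the open unit disk $|z|<1$ and on the unit circle $|z|=1$, respectively. A pair $(k,n)$ of positive integers is called valid if $1\le k\le n-1$, and a valid pair $(k,n)$ is called Littlewood-admissible if there is a Littlewood polynomial $f$ of degree $n$ with $U(f)=0$ and $N(f)=k$. Theorem. Let $n\ge 6$ be even. Then for every odd integer $k\in[3,n-3]$ and every even integer $k\in[n/3,2n/3]$, the pair $(k,n)$ is valid and Littlewood-admissible. Likewise, let $n>6$ be odd. Then for every odd integer $k\in[3,n/2]$ and every even integer $k\in[n/2,n-3]$, the pair $(k,n)$ is valid and Littlewood-admissible. -/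

import Mathlib

open Polynomial

/-- `f` is a Littlewood polynomial of degree `n`: `f = a₀ + a₁ z + ⋯ + aₙ zⁿ` in `ℤ[z]` with
every coefficient `a₀, …, aₙ` equal to `1` or `-1`. -/
def IsLittlewood (n : ℕ) (f : ℤ[X]) : Prop :=
  f.natDegree = n ∧ ∀ j ≤ n, f.coeff j = 1 ∨ f.coeff j = -1

open Classical in
/-- `N(f)`: the number of complex zeros of `f`, counted with multiplicity, in the open unit disk. -/
noncomputable def numZerosInDisk (f : ℤ[X]) : ℕ :=
  (f.map (Int.castRingHom ℂ)).roots.countP (fun z => ‖z‖ < 1)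

open Classical in
/-- `U(f)`: the number of complex zeros of `f`, counted with multiplicity, on the unit circle. -/
noncomputable def numUnimodularZeros (f : ℤ[X]) : ℕ :=
  (f.map (Int.castRingHom ℂ)).roots.countP (fun z => ‖z‖ = 1)

/-- `(k, n)` is a valid pair: `1 ≤ k ≤ n - 1`. -/
def IsValidPair (k n : ℕ) : Prop := 1 ≤ k ∧ k + 1 ≤ n

/-- The pair `(k, n)` is Littlewood-admissible: it is valid, and some Littlewood polynomial `f` of
degree `n` has `U(f) = 0` and `N(f) = k`. -/
def LittlewoodAdmissible (k n : ℕ) : Prop :=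
  IsValidPair k n ∧ ∃ f : ℤ[X], IsLittlewood n f ∧ numUnimodularZeros f = 0 ∧ numZerosInDisk f = k

/-! Multiplying by `1 - z` turns a Littlewood polynomial `f` with long constant runs of coefficients
into a sparser one: `(1 - z) f = S + z ^ (n + 1)`, where `S` does not depend on the length of the
last run. If `|S| ≥ 1` on the unit circle and the sum vanishes there only at `z = 1`, then `(1 - z)
f / S` has positive real part off `1`. The argument principle then gives `f` and `S` equally many
zeros in the disk, once the sign of `f / S` at `1` is right (`diskCount_eq_of_one_le_norm`).

For even `n`, write `k = 2 ^ a * m` with `m` odd and put `j = 2 ^ a`. The choice `S = 1 - 2 z ^ j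
G`, with `G = (1 + z ^ (2 j m)) / (1 + z ^ (2 j))`, has `j m = k` zeros in the disk. Points of the
circle where `|S| = 1` are harmless because `n + 1` is odd. This gives every `k ≤ n / 2`.

For odd `n` that parity argument fails, so for odd `k ≥ 3` the case `j = 1` is modified at both ends
until `|S| > 1` off `z = 1`. The zeros of the modified `S` are counted by deforming it to `z ^ 2`
times the old one.

Reversing the coefficients exchanges `k` and `n - k`, which gives the remaining values. -/

open Classical in
/-- The number of zeros of a complex polynomial in the open unit disk, with multiplicity. -/
noncomputable def diskCount (p : ℂ[X]) : ℕ := p.roots.countP (fun z => ‖z‖ < 1)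

theorem diskCount_mul {p q : ℂ[X]} (h : p * q ≠ 0) :
    diskCount (p * q) = diskCount p + diskCount q := by
  simp [diskCount, roots_mul h]

theorem diskCount_X_pow (n : ℕ) : diskCount (X ^ n) = n := by
  simp [diskCount, Multiset.countP_nsmul, ← Multiset.cons_zero]

theorem diskCount_neg (p : ℂ[X]) : diskCount (-p) = diskCount p := by
  simp [diskCount]

theorem diskCount_C_sub_X {c : ℂ} (hc : 1 ≤ ‖c‖) : diskCount (C c - X) = 0 := by
  rw [← diskCount_neg, neg_sub]
  simp [diskCount, ← Multiset.cons_zero, hc]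

theorem diskCount_comp_C_mul_X (p : ℂ[X]) {w : ℂ} (hw : ‖w‖ = 1) :
    diskCount (p.comp (C w * X)) = diskCount p := by
  have hw0 : w ≠ 0 := by rintro rfl; simp at hw
  have := roots_comp_C_mul_X_add_C p w 0 hw0.isUnit
  simp only [C_0, add_zero, sub_zero] at this
  rw [diskCount, this, Multiset.countP_map, diskCount, ← Multiset.countP_eq_card_filter]
  simp [Ring.inverse_eq_inv, hw]

/-! ### The argument principle and comparison of zero counts -/

theorem circleIntegral_sum_inv_sub (s : Multiset ℂ) (hs : ∀ r ∈ s, ‖r‖ ≠ 1) :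
    CircleIntegrable (fun z => (s.map fun r => 1 / (z - r)).sum) 0 1 ∧
    (∮ z in C(0, 1), (s.map fun r => 1 / (z - r)).sum) =
      2 * Real.pi * Complex.I * (s.filter fun r => ‖r‖ < 1).card := by
  induction s using Multiset.induction_on with
  | empty => simp [circleIntegral, CircleIntegrable]
  | cons a s ih =>
    obtain ⟨h1, h2⟩ := ih fun r hr => hs r (Multiset.mem_cons_of_mem hr)
    have ha := hs a (Multiset.mem_cons_self a s)
    have hi : CircleIntegrable (fun z => 1 / (z - a)) 0 1 := by
      refine ContinuousOn.circleIntegrable zero_le_one ?_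
      refine continuousOn_const.div (by fun_prop) fun z hz h => ha ?_
      rw [← sub_eq_zero.1 h]; simpa using hz
    simp only [Multiset.map_cons, Multiset.sum_cons]
    refine ⟨hi.add h1, ?_⟩
    rw [circleIntegral.integral_add hi h1, h2]
    by_cases hlt : ‖a‖ < 1
    · have := circleIntegral.integral_sub_inv_of_mem_ball (c := 0) (R := 1) (w := a) (by simpa)
      simp only [one_div, this, Multiset.filter_cons, hlt, if_true, Multiset.card_add,
        Multiset.card_singleton]
      push_cast; ring
    · have hne : ∀ z ∈ Metric.closedBall (0 : ℂ) 1, z - a ≠ 0 := by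
        intro z hz h
        rw [sub_eq_zero.1 h] at hz
        simp at hz
        exact ha (le_antisymm hz (not_lt.1 hlt))
      have := Complex.circleIntegral_eq_zero_of_differentiable_on_off_countable
        (R := 1) zero_le_one (f := fun z => 1 / (z - a)) (c := 0) Set.countable_empty
        (continuousOn_const.div (by fun_prop) hne)
        (fun z hz => (differentiableAt_const _).div (by fun_prop)
          (hne z (Metric.ball_subset_closedBall hz.1)))
      rw [this, zero_add, Multiset.filter_cons_of_neg (p := fun r : ℂ => ‖r‖ < 1) s hlt]

theorem circleIntegral_logDeriv (p : ℂ[X]) (hp : ∀ z : ℂ, ‖z‖ = 1 → p.eval z ≠ 0) :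
    CircleIntegrable (fun z => p.derivative.eval z / p.eval z) 0 1 ∧
    (∮ z in C(0, 1), p.derivative.eval z / p.eval z) =
      2 * Real.pi * Complex.I * diskCount p := by
  have hs : ∀ r ∈ p.roots, ‖r‖ ≠ 1 := fun r hr h => hp r h (isRoot_of_mem_roots hr)
  obtain ⟨-, h2⟩ := circleIntegral_sum_inv_sub p.roots hs
  refine ⟨ContinuousOn.circleIntegrable zero_le_one
    (p.derivative.continuous.continuousOn.div p.continuous.continuousOn fun z hz =>
      hp z (by simpa using hz)), ?_⟩
  rw [diskCount, Multiset.countP_eq_card_filter, ← h2]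
  refine circleIntegral.integral_congr zero_le_one fun z hz => ?_
  exact (IsAlgClosed.splits p).eval_derivative_div_eval_of_ne_zero (hp z (by simpa using hz))

/-- The principal logarithm of `p / q` is a primitive of `p' / p - q' / q` along the circle, so the
two argument-principle integrals agree. -/
theorem diskCount_eq_of_div_mem_slitPlane {p q : ℂ[X]}
    (h : ∀ z : ℂ, ‖z‖ = 1 → q.eval z ≠ 0 ∧ p.eval z / q.eval z ∈ Complex.slitPlane) :
    diskCount p = diskCount q := by
  have hp : ∀ z : ℂ, ‖z‖ = 1 → p.eval z ≠ 0 := fun z hz h0 =>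
    Complex.slitPlane_ne_zero (h z hz).2 (by simp [h0])
  obtain ⟨ip, hp'⟩ := circleIntegral_logDeriv p hp
  obtain ⟨iq, hq'⟩ := circleIntegral_logDeriv q fun z hz => (h z hz).1
  have key : (∮ z in C(0, 1),
      (p.derivative.eval z / p.eval z - q.derivative.eval z / q.eval z)) = 0 := by
    refine circleIntegral.integral_eq_zero_of_hasDerivWithinAt zero_le_one
      (f := fun z => Complex.log (p.eval z / q.eval z)) fun z hz => ?_
    have hz' : ‖z‖ = 1 := by simpa using hz
    have hpz := hp z hz'
    have hqz := (h z hz').1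
    have hd : HasDerivAt (fun t => p.eval t / q.eval t) _ z :=
      (p.hasDerivAt z).div (q.hasDerivAt z) hqz
    convert (hd.clog (h z hz').2).hasDerivWithinAt using 1
    field_simp
  rw [circleIntegral.integral_sub ip iq, hp', hq', ← mul_sub] at key
  have h2 : (2 * Real.pi * Complex.I : ℂ) ≠ 0 := Complex.two_pi_I_ne_zero
  have := (mul_eq_zero.1 key).resolve_left h2
  exact_mod_cast sub_eq_zero.1 this

theorem diskCount_eq_of_segment_ne_zero {p q : ℂ[X]}
    (h : ∀ z : ℂ, ‖z‖ = 1 → ∀ t ∈ Set.Icc (0 : ℝ) 1, (1 - t) * p.eval z + t * q.eval z ≠ 0) :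
    diskCount p = diskCount q := by
  refine diskCount_eq_of_div_mem_slitPlane fun z hz => ?_
  have hq : q.eval z ≠ 0 := by simpa using h z hz 1 (by simp)
  refine ⟨hq, ?_⟩
  rw [Complex.mem_slitPlane_iff_not_le_zero]
  intro hle
  obtain ⟨r, hr⟩ : ∃ r : ℝ, p.eval z / q.eval z = -r := by
    refine ⟨-(p.eval z / q.eval z).re, ?_⟩
    have := (Complex.le_def.1 hle).2
    apply Complex.ext <;> simp_all
  have hr0 : 0 ≤ r := by
    rw [hr] at hle
    have := (Complex.le_def.1 hle).1
    simpa using this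
  -- If `p = -r q` at `z`, the segment from `p` to `q` meets `0` at exactly this parameter.
  refine h z hz (r / (1 + r)) ⟨by positivity, (div_le_one (by positivity)).2 (by linarith)⟩ ?_
  have h1 : (1 + r : ℂ) ≠ 0 := by
    have : (1 + r : ℝ) ≠ 0 := by positivity
    exact_mod_cast this
  rw [div_eq_iff hq] at hr
  rw [hr]
  push_cast
  field_simp
  ring

theorem mul_mem_slitPlane_of_re_pos {a b : ℂ} (ha : 0 < a.re) (hb : 0 < b.re) :
    a * b ∈ Complex.slitPlane := by
  rw [Complex.mem_slitPlane_iff]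
  by_contra! h
  simp only [Complex.mul_re, Complex.mul_im] at h
  obtain ⟨h1, h2⟩ := h
  have h3 : a.re * (a.re * b.re - a.im * b.im) = b.re * (a.re ^ 2 + a.im ^ 2) := by
    linear_combination -a.im * h2
  have h4 : 0 < b.re * (a.re ^ 2 + a.im ^ 2) := by positivity
  nlinarith

open Filter Topology in
/-- If `(1 - z) f(z) / S(z)` has positive real part on the unit circle away from `1`, then `f` has
as many zeros in the disk as `S`, provided that the sign at `1` is right. -/
theorem diskCount_eq_of_re_pos {f S : ℂ[X]} (hS : ∀ z : ℂ, ‖z‖ = 1 → S.eval z ≠ 0)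
    (h : ∀ z : ℂ, ‖z‖ = 1 → z ≠ 1 → 0 < ((1 - z) * f.eval z / S.eval z).re)
    (h1 : 0 < (f.eval 1 / S.eval 1).re) : diskCount f = diskCount S := by
  -- The zero of `1 - z` on the circle is pushed out to some `c > 1`, adding no zero in the disk.
  -- Compactness makes one `c` work for all `z`; near `z = 1` both `f / S` and `c - z` have positive
  -- real part.
  have key : ∀ᶠ c : ℝ in 𝓝 1, ∀ z ∈ Metric.sphere (0 : ℂ) 1,
      ‖z‖ = 1 → 1 < c → f.eval z * (c - z) / S.eval z ∈ Complex.slitPlane := by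
    refine (isCompact_sphere (0 : ℂ) 1).eventually_forall_of_forall_eventually (P := fun (c : ℝ) z =>
      ‖z‖ = 1 → 1 < c → f.eval z * (c - z) / S.eval z ∈ Complex.slitPlane) ?_
    intro z hz
    have hz1 : ‖z‖ = 1 := by simpa using hz
    by_cases hz' : z = 1
    · subst hz'
      have hc : ContinuousAt (fun x : ℝ × ℂ => (f.eval x.2 / S.eval x.2).re) (1, 1) := by
        refine Complex.continuous_re.continuousAt.comp (ContinuousAt.div ?_ ?_ (hS 1 hz1))
        · exact (f.continuous.comp continuous_snd).continuousAt
        · exact (S.continuous.comp continuous_snd).continuousAt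
      filter_upwards [hc.eventually (lt_mem_nhds h1)] with x hx hx1 hxc
      rw [mul_div_right_comm]
      refine mul_mem_slitPlane_of_re_pos hx ?_
      have := Complex.re_le_norm x.2
      simp only [Complex.sub_re, Complex.ofReal_re]
      linarith
    · have hc : ContinuousAt (fun x : ℝ × ℂ => (f.eval x.2 * (x.1 - x.2) / S.eval x.2).re) (1, z) := by
        refine Complex.continuous_re.continuousAt.comp (ContinuousAt.div ?_ ?_ (hS z hz1))
        · exact ((f.continuous.comp continuous_snd).mul (by fun_prop)).continuousAt
        · exact (S.continuous.comp continuous_snd).continuousAt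
      have h0 : 0 < (f.eval z * (((1 : ℝ) : ℂ) - z) / S.eval z).re := by
        have := h z hz1 hz'
        rwa [mul_comm, ← Complex.ofReal_one] at this
      filter_upwards [hc.eventually (lt_mem_nhds h0)] with x hx _ _
      exact Complex.mem_slitPlane_iff.2 (Or.inl hx)
  obtain ⟨c, hc, hc1⟩ := ((key.filter_mono nhdsWithin_le_nhds).and
    (self_mem_nhdsWithin (s := Set.Ioi (1 : ℝ)))).exists
  have hc1 : 1 < c := hc1
  have hf : f ≠ 0 := by rintro rfl; simp at h1
  have hX : C (c : ℂ) - X ≠ 0 := fun h0 => by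
    have := congrArg (eval 0) h0
    simp at this
    linarith
  have e : diskCount (f * (C (c : ℂ) - X)) = diskCount S := by
    refine diskCount_eq_of_div_mem_slitPlane fun z hz => ⟨hS z hz, ?_⟩
    simpa using hc z (by simpa using hz) hz hc1
  rw [← e, diskCount_mul (mul_ne_zero hf hX), diskCount_C_sub_X, add_zero]
  rw [Complex.norm_real, Real.norm_eq_abs, abs_of_pos (by linarith)]
  exact hc1.le

/-- The quotient `(1 - z) f / S` equals `1 + w` with `‖w‖ ≤ 1`, so its real part is positive unless
`w = -1`, which `hne` excludes. -/
theorem diskCount_eq_of_one_le_norm {f S : ℂ[X]} {n : ℕ}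
    (hf : ∀ z : ℂ, (1 - z) * f.eval z = S.eval z + z ^ n)
    (hS : ∀ z : ℂ, ‖z‖ = 1 → 1 ≤ ‖S.eval z‖)
    (hne : ∀ z : ℂ, ‖z‖ = 1 → z ≠ 1 → S.eval z + z ^ n ≠ 0)
    (h1 : 0 < (f.eval 1 / S.eval 1).re) :
    (∀ z : ℂ, ‖z‖ = 1 → f.eval z ≠ 0) ∧ diskCount f = diskCount S := by
  have hS0 : ∀ z : ℂ, ‖z‖ = 1 → S.eval z ≠ 0 := fun z hz h => by
    have := hS z hz
    rw [h, norm_zero] at this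
    linarith
  constructor
  · intro z hz h0
    by_cases hz1 : z = 1
    · subst hz1; simp [h0] at h1
    · exact hne z hz hz1 (by rw [← hf, h0, mul_zero])
  · refine diskCount_eq_of_re_pos hS0 (fun z hz hz1 => ?_) h1
    have hs := hS0 z hz
    have h2 := hne z hz hz1
    rw [hf, add_div, div_self hs]
    set w := z ^ n / S.eval z with hw
    have hw1 : ‖w‖ ≤ 1 := by
      rw [hw, norm_div, norm_pow, hz, one_pow]
      exact (div_le_one (by linarith [hS z hz])).2 (hS z hz)
    have hw2 : 1 + w ≠ 0 := fun h => h2 (by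
      rw [hw] at h
      field_simp at h
      simpa using h)
    rw [Complex.add_re, Complex.one_re]
    by_contra! hle
    have h3 : w.re ^ 2 + w.im ^ 2 ≤ 1 := by
      have := Complex.sq_norm w
      rw [Complex.normSq_apply] at this
      nlinarith [norm_nonneg w]
    have h4 : w.re = -1 := by nlinarith [sq_nonneg w.im]
    have h5 : w.im = 0 := by rw [h4] at h3; nlinarith [sq_nonneg w.im]
    exact hw2 (Complex.ext (by simp [h4]) (by simp [h5]))

/-! ### Reversed polynomials -/

theorem reverse_X_sub_C {r : ℂ} (hr : r ≠ 0) :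
    (X - C r : ℂ[X]).reverse = C (-r) * (X - C r⁻¹) := by
  rw [sub_eq_add_neg, ← C_neg, reverse_add_C]
  have : (X : ℂ[X]).reverse = 1 := by
    rw [← one_mul (X : ℂ[X]), reverse_mul_X, ← C_1, reverse_C]
  rw [this, natDegree_X, pow_one, mul_sub, ← C_mul]
  simp [hr, sub_eq_add_neg, add_comm]

theorem roots_reverse {p : ℂ[X]} (hp : p.eval 0 ≠ 0) :
    p.reverse.roots = p.roots.map fun r => r⁻¹ := by
  have key : ∀ s : Multiset ℂ, (0 : ℂ) ∉ s → ∀ a : ℂ, a ≠ 0 →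
      ∃ b : ℂ, b ≠ 0 ∧ (C a * (s.map fun r => X - C r).prod).reverse =
        C b * ((s.map fun r => r⁻¹).map fun r => X - C r).prod := by
    intro s
    induction s using Multiset.induction_on with
    | empty => intro _ a ha; exact ⟨a, ha, by simp⟩
    | cons r s ih =>
      intro h a ha
      simp only [Multiset.mem_cons, not_or] at h
      obtain ⟨b, hb, e⟩ := ih h.2 a ha
      have hr : r ≠ 0 := fun h0 => h.1 h0.symm
      refine ⟨-r * b, by simp [hr, hb], ?_⟩
      simp only [Multiset.map_cons, Multiset.prod_cons]
      rw [mul_left_comm, reverse_mul_of_domain, e, reverse_X_sub_C hr, C_mul]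
      ring
  have hp0 : p ≠ 0 := by rintro rfl; simp at hp
  obtain ⟨b, hb, e⟩ := key p.roots (fun h => hp (isRoot_of_mem_roots h)) p.leadingCoeff
    (leadingCoeff_ne_zero.2 hp0)
  rw [← (IsAlgClosed.splits p).eq_prod_roots] at e
  rw [e, roots_C_mul _ hb, roots_multiset_prod_X_sub_C]

theorem diskCount_reverse {p : ℂ[X]} (hp : p.eval 0 ≠ 0) (h : ∀ z : ℂ, ‖z‖ = 1 → p.eval z ≠ 0) :
    diskCount p.reverse + diskCount p = p.natDegree := by
  have hc := (IsAlgClosed.splits p).natDegree_eq_card_roots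
  have e : diskCount p.reverse = p.roots.countP fun z => ¬ ‖z‖ < 1 := by
    rw [diskCount, roots_reverse hp, Multiset.countP_map, Multiset.countP_eq_card_filter]
    congr 1
    refine Multiset.filter_congr fun z hz => ?_
    have hz1 : ‖z‖ ≠ 1 := fun h1 => h z h1 (isRoot_of_mem_roots hz)
    have hz0 : z ≠ 0 := by rintro rfl; exact hp (isRoot_of_mem_roots hz)
    rw [norm_inv, inv_lt_one₀ (norm_pos_iff.2 hz0), not_lt]
    exact ⟨le_of_lt, fun h => lt_of_le_of_ne h hz1.symm⟩
  rw [e, diskCount, hc, add_comm, ← Multiset.card_eq_countP_add_countP]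

/-! ### Assembling Littlewood polynomials from blocks of signs -/

/-- The first `n` coefficients of `f` are `±1` and the others vanish. -/
def IsSignBlock (n : ℕ) (f : ℤ[X]) : Prop :=
  (∀ j < n, f.coeff j = 1 ∨ f.coeff j = -1) ∧ ∀ j, n ≤ j → f.coeff j = 0

theorem IsSignBlock.append {a b : ℕ} {f g : ℤ[X]} (hf : IsSignBlock a f) (hg : IsSignBlock b g) :
    IsSignBlock (a + b) (f + X ^ a * g) := by
  constructor
  · intro j hj
    rw [coeff_add, coeff_X_pow_mul']
    split_ifs with h
    · rw [hf.2 j h, zero_add]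
      exact hg.1 _ (by omega)
    · simpa using hf.1 j (by omega)
  · intro j hj
    rw [coeff_add, coeff_X_pow_mul', if_pos (by omega), hf.2 j (by omega), hg.2 _ (by omega),
      add_zero]

theorem IsSignBlock.neg {a : ℕ} {f : ℤ[X]} (hf : IsSignBlock a f) : IsSignBlock a (-f) := by
  constructor
  · intro j hj
    rcases hf.1 j hj with h | h <;> simp [h]
  · intro j hj
    simp [hf.2 j hj]

theorem isSignBlock_one : IsSignBlock 1 1 :=
  ⟨fun j hj => by simp [Nat.lt_one_iff.1 hj], fun j hj => by
    rw [coeff_one, if_neg (by omega)]⟩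

theorem isSignBlock_geom (n : ℕ) : IsSignBlock n (∑ i ∈ Finset.range n, X ^ i) := by
  induction n with
  | zero => exact ⟨fun j hj => by omega, fun j _ => by simp⟩
  | succ n ih => simpa [Finset.sum_range_succ] using ih.append isSignBlock_one

theorem IsSignBlock.repeat {a : ℕ} {f : ℤ[X]} (hf : IsSignBlock a f) (m : ℕ) :
    IsSignBlock (a * m) (f * ∑ i ∈ Finset.range m, (X ^ a) ^ i) := by
  induction m with
  | zero => exact ⟨fun j hj => by omega, fun j _ => by simp⟩
  | succ m ih =>
    convert ih.append hf using 1
    · ring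
    · rw [Finset.sum_range_succ]
      ring

theorem IsSignBlock.repeat_alternating {a : ℕ} {f : ℤ[X]} (hf : IsSignBlock a f) (m : ℕ) :
    IsSignBlock (a * m) (f * ∑ i ∈ Finset.range m, (-X ^ a) ^ i) := by
  induction m with
  | zero => exact ⟨fun j hj => by omega, fun j _ => by simp⟩
  | succ m ih =>
    rcases neg_one_pow_eq_or ℤ[X] m with h | h
    · convert ih.append hf using 1
      · ring
      · rw [Finset.sum_range_succ, neg_pow, h]
        ring
    · convert ih.append hf.neg using 1
      · ring
      · rw [Finset.sum_range_succ, neg_pow (X ^ a : ℤ[X]) m, h]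
        ring

theorem IsSignBlock.isLittlewood {n : ℕ} {f : ℤ[X]} (hf : IsSignBlock (n + 1) f) :
    IsLittlewood n f := by
  refine ⟨?_, fun j hj => hf.1 j (by omega)⟩
  refine natDegree_eq_of_le_of_coeff_ne_zero
    (natDegree_le_iff_coeff_eq_zero.2 fun j hj => hf.2 j hj) ?_
  rcases hf.1 n (by omega) with h | h <;> simp [h]

theorem littlewoodAdmissible_of_isSignBlock {k n : ℕ} (hk : 1 ≤ k) (hkn : k + 1 ≤ n) {f : ℤ[X]}
    (hf : IsSignBlock (n + 1) f)
    (h0 : ∀ z : ℂ, ‖z‖ = 1 → (f.map (Int.castRingHom ℂ)).eval z ≠ 0)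
    (h : diskCount (f.map (Int.castRingHom ℂ)) = k) : LittlewoodAdmissible k n := by
  refine ⟨⟨hk, hkn⟩, f, hf.isLittlewood, ?_, h⟩
  rw [numUnimodularZeros, Multiset.countP_eq_zero]
  exact fun z hz h1 => h0 z h1 (isRoot_of_mem_roots hz)

theorem LittlewoodAdmissible.reverse {k n : ℕ} (h : LittlewoodAdmissible k n) :
    LittlewoodAdmissible (n - k) n := by
  obtain ⟨⟨hk, hkn⟩, f, ⟨hd, hc⟩, hU, hN⟩ := h
  have hz : f.coeff 0 ≠ 0 := by rcases hc 0 (by omega) with h | h <;> simp [h]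
  have hf0 : f ≠ 0 := by rintro rfl; simp at hz
  set g := f.map (Int.castRingHom ℂ) with hg
  have hinj : Function.Injective (Int.castRingHom ℂ) := Int.cast_injective
  have hg0 : g ≠ 0 := (Polynomial.map_ne_zero_iff hinj).2 hf0
  have hgz : g.eval 0 ≠ 0 := by
    rw [← coeff_zero_eq_eval_zero, hg, coeff_map]
    simpa using hz
  have hgU : ∀ z : ℂ, ‖z‖ = 1 → g.eval z ≠ 0 := fun z hz1 h0 => by
    rw [numUnimodularZeros, Multiset.countP_eq_zero] at hU
    exact hU z ((mem_roots hg0).2 h0) hz1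
  have hgd : g.natDegree = n := by rw [hg, natDegree_map_eq_of_injective hinj, hd]
  have hrev : f.reverse.map (Int.castRingHom ℂ) = g.reverse := by
    rw [Polynomial.reverse, Polynomial.reverse, hgd, hd, hg, reflect_map]
  have hcount := diskCount_reverse hgz hgU
  have hN' : diskCount g = k := hN
  have hcoeff : ∀ j ≤ n, f.reverse.coeff j = f.coeff (n - j) := fun j hj => by
    rw [coeff_reverse, hd, revAt_le hj]
  refine littlewoodAdmissible_of_isSignBlock (f := f.reverse) (by omega) (by omega)
    ⟨fun j hj => ?_, fun j hj => ?_⟩ ?_ ?_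
  · rw [hcoeff j (by omega)]
    exact hc _ (by omega)
  · refine coeff_eq_zero_of_natDegree_lt (lt_of_le_of_lt (reverse_natDegree_le f) (by omega))
  · intro z hz1 h0
    rw [hrev] at h0
    have hr : z ∈ g.reverse.roots :=
      (mem_roots (by rwa [Ne, reverse_eq_zero])).2 h0
    rw [roots_reverse hgz, Multiset.mem_map] at hr
    obtain ⟨r, hr, rfl⟩ := hr
    rw [norm_inv, inv_eq_one] at hz1
    exact hgU r hz1 (isRoot_of_mem_roots hr)
  · rw [hrev]
    omega

/-! ### Identities for unimodular numbers -/

theorem re_sq_add_im_sq {u : ℂ} (hu : ‖u‖ = 1) : u.re ^ 2 + u.im ^ 2 = 1 := by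
  have := Complex.sq_norm u
  rw [hu, Complex.normSq_apply] at this
  linarith

theorem one_add_sq_of_norm_eq_one {u : ℂ} (hu : ‖u‖ = 1) : 1 + u ^ 2 = 2 * u.re * u := by
  have h := re_sq_add_im_sq hu
  apply Complex.ext
  · simp [pow_two]; linarith
  · simp [pow_two]; ring

theorem eq_one_of_re_eq_one {u : ℂ} (hu : ‖u‖ = 1) (h : u.re = 1) : u = 1 := by
  have h2 := re_sq_add_im_sq hu
  rw [h] at h2
  exact Complex.ext (by simp [h]) (by simp; nlinarith)

theorem eq_neg_one_of_re_eq_neg_one {u : ℂ} (hu : ‖u‖ = 1) (h : u.re = -1) : u = -1 := by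
  have h2 := re_sq_add_im_sq hu
  rw [h] at h2
  exact Complex.ext (by simp [h]) (by simp; nlinarith)

theorem sq_eq_neg_one_of_re_eq_zero {u : ℂ} (hu : ‖u‖ = 1) (h : u.re = 0) : u ^ 2 = -1 := by
  have := one_add_sq_of_norm_eq_one hu
  rw [h] at this
  simp at this
  linear_combination this

/-- The norm of `1 - 2 u g`, where `g = (1 + v) / (1 + u ^ 2)` with `u`, `v` unimodular. -/
theorem re_sq_mul_norm_sq_sub_one {u v g : ℂ} (hu : ‖u‖ = 1) (hv : ‖v‖ = 1)
    (hg : (1 + u ^ 2) * g = 1 + v) :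
    u.re ^ 2 * (‖1 - 2 * u * g‖ ^ 2 - 1) = 2 * (1 - u.re) * (1 + v.re) := by
  have e : (u.re : ℂ) * (1 - 2 * u * g) = u.re - 1 - v := by
    rw [one_add_sq_of_norm_eq_one hu] at hg
    linear_combination -hg
  have h1 := congrArg (fun w => ‖w‖ ^ 2) e
  simp only [norm_mul, mul_pow, Complex.norm_real, Real.norm_eq_abs, sq_abs] at h1
  rw [mul_sub, h1, Complex.sq_norm, Complex.normSq_apply]
  have h2 := re_sq_add_im_sq hv
  simp
  linear_combination h2

/-- With `1 + u ^ 2 = 2 a u`, where `a = u.re`, and `(1 + v) ^ 2 = v (2 + 2 v.re)`, a zero times `a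
^ 2` reads "real = `v` times real". Hence `v = ±1` or both reals vanish, and each case contradicts
`0 < a ^ 2 ≤ 1`. -/
theorem one_sub_four_mul_sq_ne {u v g : ℂ} (hu : ‖u‖ = 1) (hv : ‖v‖ = 1)
    (hg : (1 + u ^ 2) * g = 1 + v) (h0 : u.re ≠ 0) {t : ℝ} (ht : t ∈ Set.Icc (0 : ℝ) 1) :
    (1 - t) * ((1 - 2 * u * g) * (1 + 2 * u * g)) + t * -v ≠ 0 := by
  intro h
  set a := u.re with ha
  set b := (1 - t) * (2 + 2 * v.re) + t * a ^ 2 with hb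
  have e : ((1 - t) * a ^ 2 : ℂ) = v * b := by
    rw [one_add_sq_of_norm_eq_one hu] at hg
    have h2 := one_add_sq_of_norm_eq_one hv
    rw [hb]
    push_cast
    linear_combination (a : ℂ) ^ 2 * h + (1 - t) * (2 * a * u * g + 1 + v) * hg + (1 - t) * h2
  obtain ⟨ht0, ht1⟩ := ht
  have hvr := abs_le.1 (Complex.abs_re_le_norm v)
  rw [hv] at hvr
  have ha2 : 0 < a ^ 2 := by positivity
  have ha1 : a ^ 2 ≤ 1 := by nlinarith [re_sq_add_im_sq hu, sq_nonneg u.im]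
  have hre := congrArg Complex.re e
  have him := congrArg Complex.im e
  have h1 : ((1 - t) * a ^ 2 : ℂ) = (((1 - t) * a ^ 2 : ℝ) : ℂ) := by push_cast; ring
  rw [h1] at hre him
  simp only [Complex.ofReal_re, Complex.mul_re, Complex.ofReal_im, mul_zero, sub_zero] at hre
  simp only [Complex.ofReal_re, Complex.mul_im, Complex.ofReal_im, mul_zero, zero_add] at him
  have hv2 := re_sq_add_im_sq hv
  rcases mul_eq_zero.1 him.symm with hq | hb0
  · have hp : v.re = 1 ∨ v.re = -1 := by
      rw [hq] at hv2
      exact mul_self_eq_one_iff.1 (by linarith)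
    rcases hp with hp | hp <;> rw [hb, hp] at hre <;> nlinarith
  · rw [hb0] at hre
    rw [hb] at hb0
    have : t = 1 := by
      have : (1 - t) * a ^ 2 = 0 := by linarith
      rcases mul_eq_zero.1 this with h | h <;> nlinarith
    rw [this] at hb0
    nlinarith

/-! ### The comparison polynomial for even degree -/

/-- The alternating geometric sum `1 - X ^ (2 j) + X ^ (4 j) - ⋯` with `m` terms. -/
noncomputable def altGeom (j m : ℕ) : ℂ[X] := ∑ i ∈ Finset.range m, (-X ^ (2 * j)) ^ i

theorem eval_altGeom (j m : ℕ) (z : ℂ) :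
    (altGeom j m).eval z = ∑ i ∈ Finset.range m, (-z ^ (2 * j)) ^ i := by
  simp [altGeom, eval_finsetSum]

theorem one_add_mul_eval_altGeom {j m : ℕ} (hm : Odd m) (z : ℂ) :
    (1 + (z ^ j) ^ 2) * (altGeom j m).eval z = 1 + z ^ (2 * j * m) := by
  have := mul_neg_geom_sum (-z ^ (2 * j)) m
  rw [hm.neg_pow, ← pow_mul] at this
  rw [eval_altGeom]
  linear_combination this

theorem eval_altGeom_of_sq_eq_neg_one {j : ℕ} (m : ℕ) {z : ℂ} (h : (z ^ j) ^ 2 = -1) :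
    (altGeom j m).eval z = m := by
  rw [← pow_mul, mul_comm] at h
  simp [eval_altGeom, h]

/-- The polynomial `1 - 2 X ^ j (1 - X ^ (2 j) + X ^ (4 j) - ⋯)`. -/
noncomputable def altBase (j m : ℕ) : ℂ[X] := 1 - 2 * X ^ j * altGeom j m

theorem eval_altBase (j m : ℕ) (z : ℂ) :
    (altBase j m).eval z = 1 - 2 * z ^ j * (altGeom j m).eval z := by
  simp [altBase]

theorem norm_sq_one_sub_of_sq_eq_neg_one {u : ℂ} (hu : ‖u‖ = 1) (h : u.re = 0) (r : ℝ) :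
    ‖1 - 2 * u * r‖ ^ 2 = 1 + 4 * r ^ 2 := by
  have h2 := re_sq_add_im_sq hu
  rw [Complex.sq_norm, Complex.normSq_apply]
  simp [h]
  rw [h] at h2
  linear_combination 4 * r ^ 2 * h2

theorem one_le_norm_eval_altBase {j m : ℕ} (hm : Odd m) {z : ℂ} (hz : ‖z‖ = 1) :
    1 ≤ ‖(altBase j m).eval z‖ ∧
      (‖(altBase j m).eval z‖ = 1 → z ^ j = 1 ∨ z ^ (2 * j * m) = -1) := by
  have hu : ‖z ^ j‖ = 1 := by simp [hz]
  have hv : ‖z ^ (2 * j * m)‖ = 1 := by simp [hz]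
  rw [eval_altBase]
  by_cases h0 : (z ^ j).re = 0
  · rw [eval_altGeom_of_sq_eq_neg_one m (sq_eq_neg_one_of_re_eq_zero hu h0)]
    have := norm_sq_one_sub_of_sq_eq_neg_one hu h0 m
    have hm0 : (0 : ℝ) < m := by exact_mod_cast hm.pos
    push_cast at this
    constructor
    · nlinarith [norm_nonneg (1 - 2 * z ^ j * m)]
    · intro h
      rw [h] at this
      nlinarith
  · have key := re_sq_mul_norm_sq_sub_one hu hv (one_add_mul_eval_altGeom hm z)
    have h1 : (z ^ j).re ≤ 1 := (Complex.re_le_norm _).trans hu.le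
    have h2 : -1 ≤ (z ^ (2 * j * m)).re := by
      have := (abs_le.1 (Complex.abs_re_le_norm (z ^ (2 * j * m)))).1
      rwa [hv] at this
    have h3 : 0 < (z ^ j).re ^ 2 := by positivity
    set s := ‖1 - 2 * z ^ j * (altGeom j m).eval z‖
    constructor
    · have h4 : 0 ≤ s ^ 2 - 1 := by
        have : 0 ≤ 2 * (1 - (z ^ j).re) * (1 + (z ^ (2 * j * m)).re) :=
          mul_nonneg (by linarith) (by linarith)
        rw [← key] at this
        exact nonneg_of_mul_nonneg_right this h3
      have : 0 ≤ s := norm_nonneg _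
      nlinarith
    · intro h
      rw [h] at key
      have : (1 - (z ^ j).re) * (1 + (z ^ (2 * j * m)).re) = 0 := by linarith
      rcases mul_eq_zero.1 this with h | h
      · exact Or.inl (eq_one_of_re_eq_one hu (by linarith))
      · exact Or.inr (eq_neg_one_of_re_eq_neg_one hv (by linarith))

/-- Rotation by `w` with `w ^ j = -1` flips the sign of `X ^ j` and fixes the alternating sum. The
product of the two versions deforms to `-X ^ (2 * j * m)` without zeros on the circle, and each
factor has half the zeros. -/
theorem diskCount_altBase {j m : ℕ} (hj : 0 < j) (hm : Odd m) : diskCount (altBase j m) = j * m := by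
  obtain ⟨w, hw⟩ : ∃ w : ℂ, w ^ j = -1 := IsAlgClosed.exists_pow_nat_eq (-1) hj
  have hw1 : ‖w‖ = 1 := by
    have := congrArg norm hw
    rw [norm_pow, norm_neg, norm_one] at this
    exact (pow_eq_one_iff_of_nonneg (norm_nonneg w) hj.ne').1 this
  have hrot : ∀ z : ℂ, ((altBase j m).comp (C w * X)).eval z =
      1 + 2 * z ^ j * (altGeom j m).eval z := by
    intro z
    have h2 : (w * z) ^ (2 * j) = z ^ (2 * j) := by
      rw [mul_pow, mul_comm 2 j, pow_mul w, hw]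
      simp
    rw [eval_comp, eval_mul, eval_C, eval_X, eval_altBase, eval_altGeom, eval_altGeom, h2, mul_pow,
      hw]
    ring
  have hne : ∀ p : ℂ[X], p.eval 0 ≠ 0 → p ≠ 0 := by rintro _ h rfl; simp at h
  have h1 : altBase j m ≠ 0 := hne _ (by simp [eval_altBase, hj.ne'])
  have h2 : (altBase j m).comp (C w * X) ≠ 0 := hne _ (by rw [hrot]; simp [hj.ne'])
  have key : diskCount (altBase j m * (altBase j m).comp (C w * X)) =
      diskCount (-X ^ (2 * j * m)) := by
    refine diskCount_eq_of_segment_ne_zero fun z hz t ht => ?_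
    have hu : ‖z ^ j‖ = 1 := by simp [hz]
    have hv : ‖z ^ (2 * j * m)‖ = 1 := by simp [hz]
    rw [eval_mul, hrot, eval_altBase, eval_neg, eval_pow, eval_X]
    by_cases h0 : (z ^ j).re = 0
    · have hsq := sq_eq_neg_one_of_re_eq_zero hu h0
      rw [eval_altGeom_of_sq_eq_neg_one m hsq]
      have hv1 : z ^ (2 * j * m) = -1 := by
        rw [pow_mul, mul_comm 2 j, pow_mul, hsq, hm.neg_one_pow]
      have e : (1 - t : ℂ) * ((1 - 2 * z ^ j * m) * (1 + 2 * z ^ j * m)) + t * -z ^ (2 * j * m) =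
          (((1 - t) * (1 + 4 * m ^ 2) + t : ℝ) : ℂ) := by
        rw [hv1]
        push_cast
        linear_combination -4 * (1 - t) * m ^ 2 * hsq
      rw [e]
      obtain ⟨ht0, ht1⟩ := ht
      have : 0 < (1 - t) * (1 + 4 * (m : ℝ) ^ 2) + t := by nlinarith [sq_nonneg (m : ℝ)]
      exact_mod_cast this.ne'
    · exact one_sub_four_mul_sq_ne hu hv (one_add_mul_eval_altGeom hm z) h0 ht
  rw [diskCount_mul (mul_ne_zero h1 h2), diskCount_comp_C_mul_X _ hw1, diskCount_neg,
    diskCount_X_pow] at key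
  linarith

/-! ### Even degree -/

theorem one_sub_mul_geom_sum (n : ℕ) (z : ℂ) :
    (1 - z) * ∑ i ∈ Finset.range n, z ^ i = 1 - z ^ n := mul_neg_geom_sum z n

/-- The sign runs are `j` pluses, then alternating runs of length `2 j`, the last run being extended
by `r` minuses. The power of two in `j` and the odd `m` serve to exclude zeros on the circle. -/
theorem littlewoodAdmissible_two_pow_mul {n a m : ℕ} (hn : Even n) (hm : Odd m)
    (hkn : 2 * (2 ^ a * m) ≤ n) : LittlewoodAdmissible (2 ^ a * m) n := by
  set j := 2 ^ a with hj
  have hj0 : 0 < j := by positivity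
  have hk : 1 ≤ j * m := Nat.mul_pos hj0 hm.pos
  obtain ⟨r, hr⟩ : ∃ r, n + 1 = 2 * j * m + r := ⟨n + 1 - 2 * j * m, by
    have : 2 * (j * m) = 2 * j * m := by ring
    omega⟩
  have hr0 : 0 < r := by
    have : 2 * (j * m) = 2 * j * m := by ring
    omega
  have hodd : Odd (n + 1) := hn.add_one
  set f : ℤ[X] := (∑ i ∈ Finset.range j, X ^ i + X ^ j * -∑ i ∈ Finset.range j, X ^ i) *
    ∑ i ∈ Finset.range m, (-X ^ (2 * j)) ^ i + X ^ (2 * j * m) * -∑ i ∈ Finset.range r, X ^ i with hf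
  have hblock : IsSignBlock (n + 1) f := by
    have h := ((isSignBlock_geom j).append (isSignBlock_geom j).neg)
    rw [← two_mul] at h
    rw [hr]
    exact (h.repeat_alternating m).append (isSignBlock_geom r).neg
  set F := f.map (Int.castRingHom ℂ) with hF
  have heval : ∀ z : ℂ, F.eval z =
      (∑ i ∈ Finset.range j, z ^ i + z ^ j * -∑ i ∈ Finset.range j, z ^ i) *
        (altGeom j m).eval z + z ^ (2 * j * m) * -∑ i ∈ Finset.range r, z ^ i := by
    intro z
    simp [hF, hf, eval_altGeom, Polynomial.map_sum, eval_finsetSum]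
  have h1m : ∀ z : ℂ, (1 - z) * F.eval z = (altBase j m).eval z + z ^ (n + 1) := by
    intro z
    rw [heval, eval_altBase, hr, pow_add z (2 * j * m) r]
    have h1 := one_sub_mul_geom_sum j z
    have h2 := one_sub_mul_geom_sum r z
    have h3 := one_add_mul_eval_altGeom (j := j) hm z
    linear_combination (1 - z ^ j) * (altGeom j m).eval z * h1 - z ^ (2 * j * m) * h2 + h3
  have hval : F.eval 1 / (altBase j m).eval 1 = r := by
    have h3 := one_add_mul_eval_altGeom (j := j) hm 1
    have hS : (altBase j m).eval 1 = -1 := by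
      rw [eval_altBase]
      simp only [one_pow] at h3 ⊢
      linear_combination -h3
    rw [hS, heval]
    simp
  have hne : ∀ z : ℂ, ‖z‖ = 1 → z ≠ 1 → (altBase j m).eval z + z ^ (n + 1) ≠ 0 := by
    intro z hz hz1 h0
    have hnorm : ‖(altBase j m).eval z‖ = 1 := by
      rw [eq_neg_of_add_eq_zero_left h0, norm_neg, norm_pow, hz, one_pow]
    rcases (one_le_norm_eval_altBase hm hz).2 hnorm with h | h
    · have h3 := one_add_mul_eval_altGeom (j := j) hm z
      rw [h, mul_comm 2 j, mul_assoc, pow_mul, h, one_pow] at h3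
      rw [eval_altBase, h] at h0
      have hz2 : z ^ (n + 1) = 1 := by linear_combination h0 + h3
      -- Here `z` has order dividing both a power of two and the odd number `n + 1`, so `z = 1`.
      have hco : Nat.Coprime j (n + 1) := (Nat.coprime_two_left.2 hodd).pow_left a
      have := pow_gcd_eq_one.2 ⟨h, hz2⟩
      rw [hco.gcd_eq_one, pow_one] at this
      exact hz1 this
    · have h3 := one_add_mul_eval_altGeom (j := j) hm z
      rw [h] at h3
      by_cases hu : 1 + (z ^ j) ^ 2 = 0
      · have hre : (z ^ j).re = 0 := by
          have := one_add_sq_of_norm_eq_one (u := z ^ j) (by simp [hz])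
          rw [hu] at this
          have hz0 : z ≠ 0 := by rintro rfl; simp at hz
          simpa [hz0] using this.symm
        have hS := norm_sq_one_sub_of_sq_eq_neg_one (u := z ^ j) (by simp [hz]) hre m
        rw [eval_altBase, eval_altGeom_of_sq_eq_neg_one m
          (sq_eq_neg_one_of_re_eq_zero (by simp [hz]) hre)] at hnorm
        rw [Complex.ofReal_natCast, hnorm] at hS
        have : (0 : ℝ) < m := by exact_mod_cast hm.pos
        nlinarith
      · have hG : (altGeom j m).eval z = 0 := by
          refine (mul_eq_zero.1 (h3.trans ?_)).resolve_left hu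
          ring
        rw [eval_altBase, hG] at h0
        have hz2 : z ^ (n + 1) = -1 := by linear_combination h0
        -- The number `z ^ (2 * j * m * (n + 1))` is computed in two ways: an odd power of `-1` and
        -- an even one.
        have e1 : (z ^ (2 * j * m)) ^ (n + 1) = -1 := by rw [h, hodd.neg_one_pow]
        have e2 : (z ^ (n + 1)) ^ (2 * j * m) = 1 := by
          rw [hz2, mul_assoc, pow_mul]
          simp
        rw [← pow_mul, mul_comm, pow_mul, e2] at e1
        norm_num at e1
  obtain ⟨hU, hN⟩ := diskCount_eq_of_one_le_norm h1m
    (fun z hz => (one_le_norm_eval_altBase hm hz).1) hne (by rw [hval]; simpa using hr0)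
  exact littlewoodAdmissible_of_isSignBlock hk (by omega) hblock hU
    (hN.trans (diskCount_altBase hj0 hm))

theorem littlewoodAdmissible_of_even {n k : ℕ} (hn : Even n) (hk : 1 ≤ k) (hkn : k + 1 ≤ n) :
    LittlewoodAdmissible k n := by
  have key : ∀ l, 1 ≤ l → 2 * l ≤ n → LittlewoodAdmissible l n := by
    intro l hl hln
    obtain ⟨a, m, hm, rfl⟩ := Nat.exists_eq_two_pow_mul_odd (n := l) (by omega)
    exact littlewoodAdmissible_two_pow_mul hn hm hln
  by_cases h : 2 * k ≤ n
  · exact key k hk h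
  · have := (key (n - k) (by omega) (by omega)).reverse
    rwa [Nat.sub_sub_self (by omega)] at this

/-! ### The modified comparison polynomial and odd `k` -/

/-- This bounds a difference of two norms from below while only their squares are known explicitly.
-/
theorem sq_le_sub_sq_of_sq_le {a b c : ℝ} (h0 : 0 ≤ a ^ 2 + b ^ 2 - c ^ 2)
    (h : 4 * a ^ 2 * b ^ 2 ≤ (a ^ 2 + b ^ 2 - c ^ 2) ^ 2) : c ^ 2 ≤ (a - b) ^ 2 := by
  have : 2 * a * b ≤ a ^ 2 + b ^ 2 - c ^ 2 :=
    le_of_abs_le (abs_le_of_sq_le_sq (by linarith) h0)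
  linarith

theorem sq_lt_sub_sq_of_sq_lt {a b c : ℝ} (h0 : 0 ≤ a ^ 2 + b ^ 2 - c ^ 2)
    (h : 4 * a ^ 2 * b ^ 2 < (a ^ 2 + b ^ 2 - c ^ 2) ^ 2) : c ^ 2 < (a - b) ^ 2 := by
  have : 2 * a * b < a ^ 2 + b ^ 2 - c ^ 2 :=
    lt_of_abs_lt (abs_lt_of_sq_lt_sq (by linarith) h0)
  linarith

/-- `X ^ 2` times `altBase 1 (2 m + 1)`, corrected at both ends. -/
noncomputable def modifiedBase (m : ℕ) : ℂ[X] :=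
  X ^ 2 * altBase 1 (2 * m + 1) + ((1 - X) ^ 2 + 2 * X ^ (4 * m + 3) * (1 - X))

/-- The segment from `X ^ 2 * altBase 1 (2 m + 1)` to `modifiedBase m`, evaluated at `z`. -/
noncomputable def baseSegment (m : ℕ) (t : ℝ) (z : ℂ) : ℂ :=
  z ^ 2 * (altBase 1 (2 * m + 1)).eval z + t * ((1 - z) ^ 2 + 2 * z ^ (4 * m + 3) * (1 - z))

theorem eval_modifiedBase (m : ℕ) (z : ℂ) : (modifiedBase m).eval z = baseSegment m 1 z := by
  simp [modifiedBase, baseSegment]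

theorem baseSegment_of_re_eq_zero (m : ℕ) (t : ℝ) {z : ℂ} (hz : ‖z‖ = 1) (h : z.re = 0) :
    (baseSegment m t z).re = -(1 + 2 * t) := by
  have h2 := sq_eq_neg_one_of_re_eq_zero hz h
  have h3 : z ^ (4 * m + 3) = -z := by
    rw [pow_add, pow_mul, show z ^ 4 = (z ^ 2) ^ 2 by ring, pow_succ z 2, h2]
    simp
  have e : baseSegment m t z = ((-(1 + 2 * t) : ℝ) : ℂ) + ((4 * m + 2 - 4 * t : ℝ) : ℂ) * z := by
    rw [baseSegment, eval_altBase, eval_altGeom_of_sq_eq_neg_one _ (by rwa [pow_one]), h3]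
    push_cast
    linear_combination (1 - 2 * z * (2 * m + 1) + 3 * t) * h2
  rw [e]
  simp [h]

/-- Clearing the denominator `1 + z ^ 2 = 2 z.re z` leaves two terms whose norms depend only on
`z.re` and `t`, so the reverse triangle inequality gives a bound uniform in `m`. -/
theorem re_mul_baseSegment (m : ℕ) (t : ℝ) {z : ℂ} (hz : ‖z‖ = 1) :
    z.re * baseSegment m t z = z * ((z.re - 1) * (z + (2 * t * z.re : ℝ))) +
      z ^ (4 * m + 3) * ((2 * t * z.re : ℝ) - (1 + 2 * t * z.re : ℝ) * z) := by
  have h1 := one_add_sq_of_norm_eq_one hz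
  have h2 := one_add_mul_eval_altGeom (j := 1) (m := 2 * m + 1) ⟨m, rfl⟩ z
  have hz0 : z ≠ 0 := by rintro rfl; simp at hz
  rw [pow_one, h1] at h2
  apply mul_left_cancel₀ (mul_ne_zero two_ne_zero hz0)
  rw [baseSegment, eval_altBase, pow_one]
  have h3 : z ^ (2 * 1 * (2 * m + 1)) = z ^ (4 * m) * z ^ 2 := by ring
  have h4 : z ^ (4 * m + 3) = z ^ (4 * m) * z ^ 3 := by ring
  rw [h3] at h2
  rw [h4]
  push_cast
  linear_combination (-2 * z ^ 3) * h2 + 2 * z.re * t * z * h1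

theorem norm_sq_re_sub_one_mul_add {z : ℂ} (hz : ‖z‖ = 1) (s : ℝ) :
    ‖((z.re - 1) * (z + s) : ℂ)‖ ^ 2 = (1 - z.re) ^ 2 * (1 + 2 * s * z.re + s ^ 2) := by
  have h := re_sq_add_im_sq hz
  have e : (z.re - 1 : ℂ) = ((z.re - 1 : ℝ) : ℂ) := by push_cast; rfl
  rw [norm_mul, mul_pow, e, Complex.norm_real, Real.norm_eq_abs, sq_abs, Complex.sq_norm,
    Complex.normSq_apply]
  simp
  linear_combination (1 - z.re) ^ 2 * h

theorem norm_sq_sub_one_add_mul {z : ℂ} (hz : ‖z‖ = 1) (s : ℝ) :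
    ‖((s : ℝ) - (1 + s : ℝ) * z : ℂ)‖ ^ 2 = 1 + 2 * (1 - z.re) * (s + s ^ 2) := by
  have h := re_sq_add_im_sq hz
  rw [Complex.sq_norm, Complex.normSq_apply]
  simp
  linear_combination (1 + s) ^ 2 * h

theorem le_norm_baseSegment (m : ℕ) {t : ℝ} (ht : t ∈ Set.Icc (0 : ℝ) 1) {z : ℂ} (hz : ‖z‖ = 1) :
    1 ≤ ‖baseSegment m t z‖ ∧ (t = 1 → z ≠ 1 → 1 < ‖baseSegment m t z‖) := by
  obtain ⟨ht0, ht1⟩ := ht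
  by_cases h0 : z.re = 0
  · have h1 := (abs_le.1 (Complex.abs_re_le_norm (baseSegment m t z))).1
    rw [baseSegment_of_re_eq_zero m t hz h0] at h1
    exact ⟨by linarith, fun h _ => by linarith⟩
  · set c := z.re with hc
    set p : ℂ := (c - 1) * (z + (2 * t * c : ℝ)) with hp
    set q : ℂ := (2 * t * c : ℝ) - (1 + 2 * t * c : ℝ) * z with hq
    have hX : ‖p‖ ^ 2 = (1 - c) ^ 2 * (1 + 2 * (2 * t * c) * c + (2 * t * c) ^ 2) :=
      norm_sq_re_sub_one_mul_add hz _
    have hY : ‖q‖ ^ 2 = 1 + 2 * (1 - c) * (2 * t * c + (2 * t * c) ^ 2) := norm_sq_sub_one_add_mul hz _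
    have hb : (‖p‖ - ‖q‖) ^ 2 ≤ c ^ 2 * ‖baseSegment m t z‖ ^ 2 := by
      have h1 := congrArg (fun w => ‖w‖) (re_mul_baseSegment m t hz)
      simp only [norm_mul, Complex.norm_real, Real.norm_eq_abs] at h1
      have h2 : |‖p‖ - ‖q‖| ≤ |c| * ‖baseSegment m t z‖ := by
        rw [h1]
        have h3 := abs_norm_sub_norm_le (z * p) (-(z ^ (4 * m + 3) * q))
        rw [sub_neg_eq_add, norm_neg, norm_mul z p, norm_mul _ q, norm_pow, hz, one_pow, one_mul,
          one_mul] at h3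
        exact h3
      calc (‖p‖ - ‖q‖) ^ 2 = |‖p‖ - ‖q‖| ^ 2 := (sq_abs _).symm
        _ ≤ (|c| * ‖baseSegment m t z‖) ^ 2 := by gcongr
        _ = _ := by rw [mul_pow, sq_abs]
    have hc1 : c ≤ 1 := (Complex.re_le_norm z).trans hz.le
    have hc2 : -1 ≤ c := by
      have := (abs_le.1 (Complex.abs_re_le_norm z)).1
      rwa [hz] at this
    have hcpos : 0 < c ^ 2 := by positivity
    have hsum : ‖p‖ ^ 2 + ‖q‖ ^ 2 - c ^ 2 = (1 - c) * (2 + 2 * (2 * t * c) + 2 * (2 * t * c) ^ 2 +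
        (1 - c) * (4 * t * c ^ 2) + (1 - c) * (2 * t * c) ^ 2) := by
      rw [hX, hY]; ring
    have h0' : 0 ≤ ‖p‖ ^ 2 + ‖q‖ ^ 2 - c ^ 2 := by
      rw [hsum]
      have h1c : 0 ≤ 1 - c := by linarith
      have : 0 ≤ 2 + 2 * (2 * t * c) + 2 * (2 * t * c) ^ 2 := by nlinarith [sq_nonneg (2 * t * c + 1)]
      positivity
    -- This factorization is the core of the estimate: every factor is nonnegative for `0 ≤ t ≤ 1`.
    -- At `t = 1` the last bracket is at least `4`, which gives strictness for `c ≠ 1`.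
    have hdisc : (‖p‖ ^ 2 + ‖q‖ ^ 2 - c ^ 2) ^ 2 - 4 * ‖p‖ ^ 2 * ‖q‖ ^ 2 =
        4 * c ^ 2 * (1 - c) ^ 2 * (4 * t * (1 - c + t * c) +
          (2 * t * (1 - c + c ^ 2) + 2 * t ^ 2 * c * (1 + c)) ^ 2) := by
      rw [hX, hY]; ring
    have hpos : 0 ≤ 1 - c + t * c := by nlinarith
    constructor
    · have h1 : 4 * ‖p‖ ^ 2 * ‖q‖ ^ 2 ≤ (‖p‖ ^ 2 + ‖q‖ ^ 2 - c ^ 2) ^ 2 := by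
        have : 0 ≤ 4 * c ^ 2 * (1 - c) ^ 2 * (4 * t * (1 - c + t * c) +
          (2 * t * (1 - c + c ^ 2) + 2 * t ^ 2 * c * (1 + c)) ^ 2) := by positivity
        linarith
      have h2 := (sq_le_sub_sq_of_sq_le h0' h1).trans hb
      have h3 : 1 ≤ ‖baseSegment m t z‖ ^ 2 := le_of_mul_le_mul_left (by linarith) hcpos
      nlinarith [norm_nonneg (baseSegment m t z)]
    · rintro rfl hz1
      have hc1' : 0 < 1 - c :=
        sub_pos.2 (lt_of_le_of_ne hc1 fun h => hz1 (eq_one_of_re_eq_one hz h))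
      have h1 : 4 * ‖p‖ ^ 2 * ‖q‖ ^ 2 < (‖p‖ ^ 2 + ‖q‖ ^ 2 - c ^ 2) ^ 2 := by
        have : 0 < 4 * c ^ 2 * (1 - c) ^ 2 * (4 * 1 * (1 - c + 1 * c) +
          (2 * 1 * (1 - c + c ^ 2) + 2 * 1 ^ 2 * c * (1 + c)) ^ 2) := by
          have : 4 * 1 * (1 - c + 1 * c) = 4 := by ring
          rw [this]
          positivity
        linarith
      have h2 := (sq_lt_sub_sq_of_sq_lt h0' h1).trans_le hb
      have h3 : 1 < ‖baseSegment m 1 z‖ ^ 2 := lt_of_mul_lt_mul_left (by linarith) hcpos.le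
      nlinarith [norm_nonneg (baseSegment m 1 z)]

theorem diskCount_modifiedBase (m : ℕ) : diskCount (modifiedBase m) = 2 * m + 3 := by
  have h0 : X ^ 2 * altBase 1 (2 * m + 1) ≠ 0 := by
    refine mul_ne_zero (pow_ne_zero _ X_ne_zero) fun h => ?_
    have := congrArg (eval 0) h
    simp [eval_altBase] at this
  have key : diskCount (X ^ 2 * altBase 1 (2 * m + 1)) = diskCount (modifiedBase m) := by
    refine diskCount_eq_of_segment_ne_zero fun z hz t ht h => ?_
    have e : baseSegment m t z = 0 := by
      rw [← h, eval_modifiedBase, baseSegment, baseSegment]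
      simp only [eval_mul, eval_pow, eval_X, Complex.ofReal_one]
      ring
    have := (le_norm_baseSegment m ht hz).1
    rw [e, norm_zero] at this
    linarith
  rw [← key, diskCount_mul h0, diskCount_X_pow, diskCount_altBase one_pos ⟨m, rfl⟩]
  ring

/-- Pairing consecutive terms matches the sum with the period-four block `- - + +` of the next
construction. -/
theorem eval_altGeom_one (m : ℕ) (z : ℂ) : (altGeom 1 (2 * m + 1)).eval z =
    (1 - z ^ 2) * ∑ i ∈ Finset.range m, (z ^ 4) ^ i + z ^ (4 * m) := by
  rw [eval_altGeom]
  induction m with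
  | zero => simp
  | succ m ih =>
    rw [show 2 * (m + 1) + 1 = 2 * m + 1 + 1 + 1 by ring, Finset.sum_range_succ,
      Finset.sum_range_succ, ih, Finset.sum_range_succ]
    have h1 : (-z ^ (2 * 1)) ^ (2 * m + 1) = -(z ^ (4 * m) * z ^ 2) := by
      rw [Odd.neg_pow ⟨m, rfl⟩]; ring
    have h2 : (-z ^ (2 * 1)) ^ (2 * m + 1 + 1) = z ^ (4 * m) * z ^ 4 := by
      rw [Even.neg_pow ⟨m + 1, by ring⟩]; ring
    rw [h1, h2]
    ring

/-- The signs are `+ - +`, then `m` copies of `- - + +`, then `+`, then `r` minuses. No parity of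
`n` is needed, since `|S| > 1` off `z = 1`. -/
theorem littlewoodAdmissible_odd {n m : ℕ} (h : 2 * (2 * m + 3) ≤ n) :
    LittlewoodAdmissible (2 * m + 3) n := by
  obtain ⟨r, hr⟩ : ∃ r, n + 1 = 3 + 4 * m + 1 + r := ⟨n + 1 - (3 + 4 * m + 1), by omega⟩
  set f : ℤ[X] := 1 + X ^ 1 * -1 + X ^ 2 * 1 +
    X ^ 3 * ((-1 + X ^ 1 * -1 + X ^ 2 * (1 + X ^ 1 * 1)) * ∑ i ∈ Finset.range m, (X ^ 4) ^ i) +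
    X ^ (3 + 4 * m) * 1 + X ^ (3 + 4 * m + 1) * -∑ i ∈ Finset.range r, X ^ i with hf
  have hblock : IsSignBlock (n + 1) f := by
    have h1 := isSignBlock_one
    rw [hr]
    exact ((((h1.append h1.neg).append h1).append
      (((h1.neg.append h1.neg).append (h1.append h1)).repeat m)).append h1).append
      (isSignBlock_geom r).neg
  set F := f.map (Int.castRingHom ℂ) with hF
  have heval : ∀ z : ℂ, F.eval z = 1 - z + z ^ 2 +
      z ^ 3 * ((-1 - z + z ^ 2 * (1 + z)) * ∑ i ∈ Finset.range m, (z ^ 4) ^ i) +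
      z ^ (3 + 4 * m) + z ^ (3 + 4 * m + 1) * -∑ i ∈ Finset.range r, z ^ i := by
    intro z
    simp [hF, hf, Polynomial.map_sum, eval_finsetSum, ← sub_eq_add_neg]
  have h1m : ∀ z : ℂ, (1 - z) * F.eval z = (modifiedBase m).eval z + z ^ (n + 1) := by
    intro z
    rw [heval, eval_modifiedBase, baseSegment, eval_altBase, eval_altGeom_one, hr,
      pow_add z (3 + 4 * m + 1) r]
    have h2 := one_sub_mul_geom_sum r z
    have h3 := one_sub_mul_geom_sum m (z ^ 4)
    rw [← pow_mul] at h3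
    push_cast
    linear_combination (-z ^ (3 + 4 * m + 1)) * h2 + z ^ 3 * h3
  have hval : F.eval 1 / (modifiedBase m).eval 1 = ((r - 2 : ℝ) : ℂ) := by
    have hS : (modifiedBase m).eval 1 = -1 := by
      rw [eval_modifiedBase, baseSegment, eval_altBase, eval_altGeom_one]
      norm_num
    rw [hS, heval]
    simp
    ring
  obtain ⟨hU, hN⟩ := diskCount_eq_of_one_le_norm h1m
    (fun z hz => by
      rw [eval_modifiedBase]
      exact (le_norm_baseSegment m (by simp) hz).1)
    (fun z hz hz1 h0 => by
      have := (le_norm_baseSegment m (t := 1) (by simp) hz).2 rfl hz1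
      rw [← eval_modifiedBase, eq_neg_of_add_eq_zero_left h0, norm_neg, norm_pow, hz,
        one_pow] at this
      exact lt_irrefl _ this)
    (by
      rw [hval, Complex.ofReal_re]
      -- The condition `2 k ≤ n` makes the final run long enough for `f` and `S` to have the same
      -- sign at `1`.
      have : (3 : ℝ) ≤ r := by exact_mod_cast (by omega : 3 ≤ r)
      linarith)
  exact littlewoodAdmissible_of_isSignBlock (by omega) (by omega) hblock hU
    (hN.trans (diskCount_modifiedBase m))

/-! ### The theorem -/

theorem theorem2p7 (n : ℕ) :
    (6 ≤ n → Even n →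
      (∀ k : ℕ, Odd k → (k : ℝ) ∈ Set.Icc (3 : ℝ) ((n : ℝ) - 3) → LittlewoodAdmissible k n) ∧
      (∀ k : ℕ, Even k → (k : ℝ) ∈ Set.Icc ((n : ℝ) / 3) (2 * (n : ℝ) / 3) →
        LittlewoodAdmissible k n)) ∧
    (6 < n → Odd n →
      (∀ k : ℕ, Odd k → (k : ℝ) ∈ Set.Icc (3 : ℝ) ((n : ℝ) / 2) → LittlewoodAdmissible k n) ∧
      (∀ k : ℕ, Even k → (k : ℝ) ∈ Set.Icc ((n : ℝ) / 2) ((n : ℝ) - 3) →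
        LittlewoodAdmissible k n)) := by
  have hodd : ∀ k : ℕ, Odd k → 3 ≤ k → 2 * k ≤ n → LittlewoodAdmissible k n := by
    rintro k ⟨l, rfl⟩ h3 hk
    have e : 2 * l + 1 = 2 * (l - 1) + 3 := by omega
    rw [e]
    exact littlewoodAdmissible_odd (by omega)
  refine ⟨fun hn he => ⟨fun k _ ⟨h1, h2⟩ => ?_, fun k _ ⟨h1, h2⟩ => ?_⟩,
    fun hn ho => ⟨fun k hk ⟨h1, h2⟩ => ?_, fun k hk ⟨h1, h2⟩ => ?_⟩⟩
  · have h1' : 3 ≤ k := by exact_mod_cast h1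
    have h2' : k + 3 ≤ n := by exact_mod_cast (by linarith : (k : ℝ) + 3 ≤ n)
    exact littlewoodAdmissible_of_even he (by omega) (by omega)
  · have h1' : n ≤ 3 * k := by exact_mod_cast (by linarith : (n : ℝ) ≤ 3 * k)
    have h2' : 3 * k ≤ 2 * n := by exact_mod_cast (by linarith : 3 * (k : ℝ) ≤ 2 * n)
    exact littlewoodAdmissible_of_even he (by omega) (by omega)
  · have h1' : 3 ≤ k := by exact_mod_cast h1
    have h2' : 2 * k ≤ n := by exact_mod_cast (by linarith : 2 * (k : ℝ) ≤ n)
    exact hodd k hk h1' h2'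
  · have h1' : n ≤ 2 * k := by exact_mod_cast (by linarith : (n : ℝ) ≤ 2 * k)
    have h2' : k + 3 ≤ n := by exact_mod_cast (by linarith : (k : ℝ) + 3 ≤ n)
    -- For odd `n` and even `k`, the reversed index `n - k` is odd and lies between `3` and `n / 2`.
    have := (hodd (n - k) (Nat.Odd.sub_even (by omega) ho hk) (by omega) (by omega)).reverse
    rwa [Nat.sub_sub_self (by omega)] at this
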